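/- Work over $\mathbb C$ and let $n\ge 2$. Let $\Delta\subset\mathbb C$ be an open disk containing $0$, let $q\in\mathbb A^n$, and let $s_1,\dots,s_{n+1}:\Delta\to\mathbb A^n=\mathbb C^n$ be holomorphic maps with $s_i(0)=q$ for all $i$. Let $\sigma_i(t)=(s_i(t),t)$ be the corresponding sections of $\mathbb A^n\times\Delta\to\Delta$, and let $W=\mathbb P(T_{(q,0)}(\mathbb A^n\times\Delta))\cong\mathbb P^n$ be the exceptional divisor of the blow-up of $\mathbb A^n\times\Delta$ at $(q,0)$. The lift of $\sigma_i$ to the blow-up meets $W$ in the point $a_i=[s_i'(0):1]$. Assume that the sections are general in the sense that $a_1,\dots,a_{n+1}$ are linearly independent points of $W\cong\mathbb P^n$. Let $Z\subset\mathbb A^n\times\Delta$ be the union of the curves $\sigma_i(\Delta)$, each taken with multiplicity $2$, i.e. the subscheme with ideal $\bigcap_i I_{\sigma_i(\Delta)}^2$ in $\mathcal O(\Delta)[x_1,\dots,x_n]$ (so that its fibre $Z_t$ over a general $t\ne 0$ consists of $n+1$ double points), and let $Z_0\subset\mathbb A^n$ be the flat limit of $Z_t$ as $t\to0$, i.e.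 the fibre over $0$ of the scheme-theoretic closure of the part of $Z$ lying over $t\neq 0$. Let $R=\mathbb P(T_q\mathbb A^n)\cong\mathbb P^{n-1}\subset W$ be the hyperplane of tangent directions of the central fibre, and let $B\subset R$ be the set of the points in which the lines $\langle a_i,a_j\rangle\subset W$, $i\ne j$, meet $R$. Then $B$ consists of exactly $\binom{n+1}{2}$ tangent directions at $q$, the multiplicity of $Z_0$ at $q$ is $3$ (that is, $I_{Z_0}\subseteq\mathfrak m_q^3$ and $I_{Z_0}\not\subseteq\mathfrak m_q^4$), and $Z_0$ is the triple point at $q$ together with the tangent directions $B$: the ideal of $Z_0$ in $\mathbb C[x_1,\dots,x_n]$ consists exactly of the polynomials $f\in\mathfrak m_q^3$ whose homogeneous part of degree $3$ at $q$ vanishes at every point of $B$. -/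

import Mathlib

namespace Collapse

noncomputable section

open MvPolynomial
open scoped LinearAlgebra.Projectivization

/-- The ring `𝒪(U)` of holomorphic functions on an open set `U` of the complex line. -/
def holo (U : Set ℂ) : Subalgebra ℂ (U → ℂ) where
  carrier := {f | ∃ g : ℂ → ℂ, DifferentiableOn ℂ g U ∧ ∀ z : U, f z = g z}
  mul_mem' := by
    rintro a b ⟨g, hg, hag⟩ ⟨h, hh, hbh⟩
    exact ⟨g * h, hg.mul hh, fun z => by simp [hag, hbh]⟩
  add_mem' := by
    rintro a b ⟨g, hg, hag⟩ ⟨h, hh, hbh⟩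
    exact ⟨g + h, hg.add hh, fun z => by simp [hag, hbh]⟩
  algebraMap_mem' := fun w => ⟨fun _ => w, differentiableOn_const w, fun _ => rfl⟩

/-- The coordinate `t` of the base, as an element of `𝒪(U)`. -/
def param (U : Set ℂ) : holo U := ⟨fun z => (z : ℂ), fun z => z, differentiableOn_id, fun _ => rfl⟩

/-- Evaluation of holomorphic functions at the point `0` of the base. -/
def evalZero {U : Set ℂ} (h0 : (0 : ℂ) ∈ U) : holo U →+* ℂ :=
  (Pi.evalRingHom (fun _ : U => ℂ) ⟨0, h0⟩).comp (holo U).subtype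

/-- The coordinate ring `𝒪(U)[x₁, …, xₙ]` of `𝔸ⁿ × U`. -/
abbrev FamilyRing (n : ℕ) (U : Set ℂ) : Type := MvPolynomial (Fin n) (holo U)

/-- The coordinates of a section `z ↦ (s z, z)` of `𝔸ⁿ × U → U`, as elements of `𝒪(U)`. -/
def sectionCoord {n : ℕ} {U : Set ℂ} (s : ℂ → Fin n → ℂ) (hs : DifferentiableOn ℂ s U) :
    Fin n → holo U :=
  fun j => ⟨fun z => s z j, fun z => s z j, differentiableOn_pi.mp hs j, fun _ => rfl⟩

/-- The ideal of the image of a section: the functions on `𝔸ⁿ × U` whose pull-back along the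
section is zero. -/
def sectionIdeal {n : ℕ} {U : Set ℂ} (s : ℂ → Fin n → ℂ) (hs : DifferentiableOn ℂ s U) :
    Ideal (FamilyRing n U) :=
  RingHom.ker (MvPolynomial.eval (sectionCoord s hs))

/-- The ideal of the union of the images of the sections `s i`, each taken with multiplicity `2`. -/
def doubleSections {n : ℕ} {ι : Type} {U : Set ℂ} (s : ι → ℂ → Fin n → ℂ)
    (hs : ∀ i, DifferentiableOn ℂ (s i) U) : Ideal (FamilyRing n U) :=
  ⨅ i, sectionIdeal (s i) (hs i) ^ 2

/-- The ideal of the scheme-theoretic closure in `𝔸ⁿ × U` of the part of the subscheme `V(I)`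
lying over `t ≠ 0`. It is the only closed subscheme of `𝔸ⁿ × U` that agrees with `V(I)` where `t`
is invertible and on which `t` is not a zero divisor, that is, which is flat over `0`. -/
def flatClosure {n : ℕ} {U : Set ℂ} (I : Ideal (FamilyRing n U)) : Ideal (FamilyRing n U) :=
  (I.map (algebraMap (FamilyRing n U) (Localization.Away (C (param U) : FamilyRing n U)))).comap
    (algebraMap (FamilyRing n U) (Localization.Away (C (param U) : FamilyRing n U)))

/-- The ideal in `ℂ[x₁, …, xₙ]` of the flat limit, at `t = 0`, of the fibres over `t ≠ 0` of the
subscheme `V(I)` of `𝔸ⁿ × U`: the fibre over `0` of the closure. -/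
def flatLimit {n : ℕ} {U : Set ℂ} (h0 : (0 : ℂ) ∈ U) (I : Ideal (FamilyRing n U)) :
    Ideal (MvPolynomial (Fin n) ℂ) :=
  (flatClosure I).map (MvPolynomial.map (evalZero h0))

/-- The maximal ideal of the point `q` of `𝔸ⁿ`. -/
def pointIdeal {n : ℕ} (q : Fin n → ℂ) : Ideal (MvPolynomial (Fin n) ℂ) :=
  RingHom.ker (MvPolynomial.eval q)

/-- The polynomial `f (q + x)`. -/
def recenter {n : ℕ} (q : Fin n → ℂ) : MvPolynomial (Fin n) ℂ →ₐ[ℂ] MvPolynomial (Fin n) ℂ :=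
  MvPolynomial.aeval (fun j => C (q j) + X j)

/-- The degree `m` part of the Taylor expansion of `f` at `q`, a form on the tangent space `ℂⁿ`;
if `f` has multiplicity `m` at `q`, its zeros are the tangent cone of `f` at `q`. -/
def taylorForm {n : ℕ} (q : Fin n → ℂ) (m : ℕ) (f : MvPolynomial (Fin n) ℂ) :
    MvPolynomial (Fin n) ℂ :=
  homogeneousComponent m (recenter q f)

lemma sub_constantCoeff_mem {n : ℕ} (g : MvPolynomial (Fin n) ℂ) :
    g - C (constantCoeff g) ∈ idealOfVars (Fin n) ℂ := by
  have h : g - C (constantCoeff g) ∈ idealOfVars (Fin n) ℂ ^ 1 := by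
    rw [mem_pow_idealOfVars_iff']
    intro x hx
    have hx0 : x = 0 := (Finsupp.degree_eq_zero_iff x).mp (by omega)
    subst hx0
    simp [constantCoeff_eq]
  rwa [pow_one] at h

lemma recenter_mem {n : ℕ} (q : Fin n → ℂ) (m : ℕ) {f : MvPolynomial (Fin n) ℂ}
    (hf : f ∈ pointIdeal q ^ m) : recenter q f ∈ idealOfVars (Fin n) ℂ ^ m := by
  have h : (pointIdeal q).map (recenter q) ≤ idealOfVars (Fin n) ℂ := by
    rw [Ideal.map_le_iff_le_comap]
    intro g hg
    have h0 : (constantCoeff (R := ℂ) (σ := Fin n)).comp (recenter q : _ →+* _) =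
        MvPolynomial.eval q := by
      refine MvPolynomial.ringHom_ext (fun a => ?_) (fun j => ?_) <;> simp [recenter]
    have h1 : constantCoeff (recenter q g) = MvPolynomial.eval q g := RingHom.congr_fun h0 g
    have h2 := sub_constantCoeff_mem (recenter q g)
    have h3 : MvPolynomial.eval q g = 0 := hg
    rw [h1, h3, map_zero, sub_zero] at h2
    exact h2
  have h2 := Ideal.mem_map_of_mem (recenter q) hf
  rw [Ideal.map_pow] at h2
  exact Ideal.pow_right_mono h m h2

lemma taylorForm_mul {n : ℕ} (q : Fin n → ℂ) (m : ℕ) (g : MvPolynomial (Fin n) ℂ)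
    {f : MvPolynomial (Fin n) ℂ} (hf : f ∈ pointIdeal q ^ m) :
    taylorForm q m (g * f) = C (constantCoeff (recenter q g)) * taylorForm q m f := by
  have h1 := Ideal.mul_mem_mul (sub_constantCoeff_mem (recenter q g)) (recenter_mem q m hf)
  rw [← pow_succ', mem_pow_idealOfVars_iff'] at h1
  have h2 : homogeneousComponent m
      ((recenter q g - C (constantCoeff (recenter q g))) * recenter q f) = 0 := by
    ext x
    rw [coeff_homogeneousComponent, coeff_zero]
    split_ifs with hx
    · exact h1 x (by omega)
    · rfl
  rw [sub_mul, map_sub, sub_eq_zero, homogeneousComponent_C_mul] at h2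
  rw [taylorForm, taylorForm, map_mul, h2]

/-- The ideal of the point of multiplicity `m` at `q` together with the set `B` of tangent
directions at `q`: the polynomials with multiplicity at least `m` at `q` whose form of degree `m`
at `q` vanishes at all the points of `B`. -/
def fatPointWithDirections {n : ℕ} (q : Fin n → ℂ) (m : ℕ) (B : Set (ℙ ℂ (Fin n → ℂ))) :
    Ideal (MvPolynomial (Fin n) ℂ) where
  carrier := {f | f ∈ pointIdeal q ^ m ∧ ∀ (v : Fin n → ℂ) (hv : v ≠ 0),
    Projectivization.mk ℂ v hv ∈ B → MvPolynomial.eval v (taylorForm q m f) = 0}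
  zero_mem' := ⟨zero_mem _, fun v _ _ => by simp [taylorForm]⟩
  add_mem' := by
    rintro a b ⟨ha, ha'⟩ ⟨hb, hb'⟩
    refine ⟨add_mem ha hb, fun v hv hB => ?_⟩
    have h1 := ha' v hv hB
    have h2 := hb' v hv hB
    simp only [taylorForm] at h1 h2 ⊢
    rw [map_add, map_add, map_add, h1, h2, add_zero]
  smul_mem' := by
    rintro g f ⟨hf, hf'⟩
    refine ⟨Ideal.mul_mem_left _ g hf, fun v hv hB => ?_⟩
    rw [smul_eq_mul, taylorForm_mul q m g hf, map_mul, hf' v hv hB, mul_zero]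

/-- The multiplicity at `q` of the subscheme of `𝔸ⁿ` with ideal `I` is `m`: the ideal is contained
in the `m`-th power of the maximal ideal of `q`, and not in the next power. -/
def HasMultiplicity {n : ℕ} (I : Ideal (MvPolynomial (Fin n) ℂ)) (q : Fin n → ℂ) (m : ℕ) : Prop :=
  I ≤ pointIdeal q ^ m ∧ ¬ I ≤ pointIdeal q ^ (m + 1)

/-- The point where the section `z ↦ (s z, z)`, lifted to the blow-up of `𝔸ⁿ × U` at the point
`(s 0, 0)`, meets the exceptional divisor `W ≅ ℙⁿ`, the projectivized tangent space of `𝔸ⁿ × U` at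
that point: the tangent direction of the section. -/
def liftAtZero {n : ℕ} (s : ℂ → Fin n → ℂ) : ℙ ℂ ((Fin n → ℂ) × ℂ) :=
  Projectivization.mk ℂ (deriv s 0, (1 : ℂ)) (by simp)

/-- The inclusion in `W` of the hyperplane `R ≅ ℙⁿ⁻¹` of the tangent directions of the central
fibre `𝔸ⁿ × {0}`. -/
def inclR (n : ℕ) : ℙ ℂ (Fin n → ℂ) → ℙ ℂ ((Fin n → ℂ) × ℂ) :=
  Projectivization.map (LinearMap.inl ℂ (Fin n → ℂ) ℂ) LinearMap.inl_injective

/-- The line joining two distinct points of a projective space. -/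
def lineThrough {V : Type} [AddCommGroup V] [Module ℂ V] (a b : ℙ ℂ V) : Set (ℙ ℂ V) :=
  {p | p.submodule ≤ a.submodule ⊔ b.submodule}

/-- The points of `R`, that is, the tangent directions at the collapsing point, that are cut out by
the lines joining pairs of the points `a i` of `W`. -/
def cutDirections {n : ℕ} {ι : Type} (a : ι → ℙ ℂ ((Fin n → ℂ) × ℂ)) : Set (ℙ ℂ (Fin n → ℂ)) :=
  {p | ∃ i j, i ≠ j ∧ inclR n p ∈ lineThrough (a i) (a j)}

end

end Collapse

/-! Write the sections as `q + t u i` with `u i` holomorphic and `u i (0) = v i = s i'(0)`.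
Independence of the lifts says that the vectors `(v i, 1)` form a basis; let `l k` be the linear
parts of the barycentric coordinates, so that `∑ l k = 0` and `l k (v i - v j) = δ_ik - δ_jk`.

Upper bound. If `t ^ k F` is double along all sections, then on the moving line `q + t u j + y (u i
- u j)` the function `F` has double zeros at `y = 0` and at `y = t`. These collide at `t = 0`, so
the limit `f` vanishes to order 4 along the direction `v i - v j` (`X_pow_four_dvd_lineHom`). It
also vanishes to order 2 along every line through `q`. The products `l i * l j`, `i < j`, form up to
sign a dual basis to evaluation of quadrics at the `v i - v j`, so the quadratic part of `f` is zero
(`mem_pointIdeal_cube`); its cubic part vanishes on the directions `v i - v j`, which are the points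
of `B`.

Lower bound. The hyperplane through all sections but the `k`-th degenerates to a multiple of `l k`.
Products of such hyperplanes put `l i * l j * l k` (distinct indices) and `l i ^ 2 * l j ^ 2` in the
limit. With `∑ l k = 0` these generate the whole fourth power of the maximal ideal, and modulo them
cubics are spanned by `l i ^ 2 * l j`, `i < j`, whose coefficients are read off at the points of `B`
(`mem_of_lineCoeff_three_eq_zero`). -/

namespace Collapse

noncomputable section

open MvPolynomial
open scoped LinearAlgebra.Projectivization

/-! ### Zeros on lines over a base ring with a nonzerodivisor `t`. -/

section Divisibility

variable {A : Type*} [CommRing A]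

lemma X_sub_C_dvd_of_dvd_mul {c : A} {h p : Polynomial A}
    (hc : ∀ a, h.eval c * a = 0 → a = 0) (hd : (Polynomial.X - Polynomial.C c) ∣ h * p) :
    (Polynomial.X - Polynomial.C c) ∣ p := by
  rw [Polynomial.dvd_iff_isRoot, Polynomial.IsRoot.def] at hd ⊢
  rw [Polynomial.eval_mul] at hd
  exact hc _ hd

lemma X_sub_C_sq_dvd_of_dvd_mul {c : A} {h p : Polynomial A}
    (hc : ∀ a, h.eval c * a = 0 → a = 0) (hd : (Polynomial.X - Polynomial.C c) ^ 2 ∣ h * p) :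
    (Polynomial.X - Polynomial.C c) ^ 2 ∣ p := by
  obtain ⟨p₁, rfl⟩ := X_sub_C_dvd_of_dvd_mul hc ((dvd_pow_self _ two_ne_zero).trans hd)
  obtain ⟨r, hr⟩ := hd
  have hreg := (Polynomial.monic_X_sub_C c).isRegular.left
  have h1 : h * p₁ = (Polynomial.X - Polynomial.C c) * r := by
    apply hreg
    simp only
    rw [← mul_assoc _ _ r, ← sq, ← hr]
    ring
  rw [sq]
  exact mul_dvd_mul_left _ (X_sub_C_dvd_of_dvd_mul hc ⟨r, h1⟩)

/-- The two factors are not coprime, since they meet at `t = 0`; it is enough that `X ^ 2` takes the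
nonzerodivisor value `t ^ 2` at `t`. -/
lemma X_sq_mul_X_sub_C_sq_dvd {t : A} (ht : ∀ a, t * a = 0 → a = 0) {p : Polynomial A}
    (h₀ : Polynomial.X ^ 2 ∣ p) (h₁ : (Polynomial.X - Polynomial.C t) ^ 2 ∣ p) :
    Polynomial.X ^ 2 * (Polynomial.X - Polynomial.C t) ^ 2 ∣ p := by
  obtain ⟨g, rfl⟩ := h₀
  refine mul_dvd_mul_left _ (X_sub_C_sq_dvd_of_dvd_mul (h := Polynomial.X ^ 2) (fun a ha => ?_) h₁)
  rw [Polynomial.eval_pow, Polynomial.eval_X, sq, mul_assoc] at ha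
  exact ht _ (ht _ ha)

lemma regular_pow {t : A} (ht : ∀ a, t * a = 0 → a = 0) (k : ℕ) (a : A) (ha : t ^ k * a = 0) :
    a = 0 := by
  induction k with
  | zero => simpa using ha
  | succ k ih => exact ih (ht _ (by rw [← mul_assoc, ← pow_succ', ha]))

/-- The restriction of a polynomial to the parametrized line `y ↦ b + y w`. -/
def lineHom {n : ℕ} (b w : Fin n → A) : MvPolynomial (Fin n) A →ₐ[A] Polynomial A :=
  MvPolynomial.aeval fun j => Polynomial.C (b j) + Polynomial.X * Polynomial.C (w j)

lemma eval_lineHom {n : ℕ} (b w : Fin n → A) (c : A) (F : MvPolynomial (Fin n) A) :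
    (lineHom b w F).eval c = MvPolynomial.eval (fun j => b j + c * w j) F := by
  have h : (Polynomial.evalRingHom c).comp (lineHom b w : _ →+* _) =
      MvPolynomial.eval (fun j => b j + c * w j) := by
    refine MvPolynomial.ringHom_ext (fun a => ?_) (fun j => ?_)
    · simp [lineHom]
    · simp [lineHom, mul_comm c]
  exact RingHom.congr_fun h F

lemma map_lineHom {A' : Type*} [CommRing A'] (e : A →+* A') {n : ℕ} (b w : Fin n → A)
    (F : MvPolynomial (Fin n) A) :
    (lineHom b w F).map e = lineHom (fun j => e (b j)) (fun j => e (w j)) (F.map e) := by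
  have h : (Polynomial.mapRingHom e).comp (lineHom b w : _ →+* _) =
      ((lineHom (fun j => e (b j)) (fun j => e (w j))).toRingHom).comp (MvPolynomial.map e) := by
    refine MvPolynomial.ringHom_ext (fun a => ?_) (fun j => ?_) <;> simp [lineHom]
  exact RingHom.congr_fun h F

lemma X_sub_C_sq_dvd_lineHom {n : ℕ} (b w σ : Fin n → A) (c : A)
    (hσ : ∀ j, b j + c * w j = σ j) {F : MvPolynomial (Fin n) A}
    (hF : F ∈ RingHom.ker (MvPolynomial.eval σ) ^ 2) :
    (Polynomial.X - Polynomial.C c) ^ 2 ∣ lineHom b w F := by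
  have h : (RingHom.ker (MvPolynomial.eval σ)).map (lineHom b w) ≤
      Ideal.span {Polynomial.X - Polynomial.C c} := by
    rw [Ideal.map_le_iff_le_comap]
    intro G hG
    rw [Ideal.mem_comap, Ideal.mem_span_singleton, Polynomial.dvd_iff_isRoot,
      Polynomial.IsRoot.def]
    erw [eval_lineHom]
    rw [funext hσ]
    exact hG
  have h2 := Ideal.mem_map_of_mem (lineHom b w) hF
  rw [Ideal.map_pow] at h2
  have h3 := Ideal.pow_right_mono h 2 h2
  rwa [Ideal.span_singleton_pow, Ideal.mem_span_singleton] at h3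

/-- If a multiple `t ^ k F` has double points at the sections `σ` and `σ + t w`, then the
specialization of `F` at `t = 0` vanishes to order four along the limit line. -/
lemma X_pow_four_dvd_lineHom {A' : Type*} [CommRing A'] (e : A →+* A') {t : A}
    (ht : ∀ a, t * a = 0 → a = 0) (het : e t = 0) {n : ℕ} (σ w σ' : Fin n → A)
    (hσ : ∀ j, σ j + t * w j = σ' j) {F : MvPolynomial (Fin n) A} (k : ℕ)
    (h : C t ^ k * F ∈ RingHom.ker (MvPolynomial.eval σ) ^ 2)
    (h' : C t ^ k * F ∈ RingHom.ker (MvPolynomial.eval σ') ^ 2) :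
    Polynomial.X ^ 4 ∣ lineHom (fun j => e (σ j)) (fun j => e (w j)) (F.map e) := by
  -- On the line the factor `t ^ k` is constant, so its value at any `c` is a nonzerodivisor and it
  -- can be cancelled.
  have key : ∀ c : A, (Polynomial.X - Polynomial.C c) ^ 2 ∣ lineHom σ w (C t ^ k * F) →
      (Polynomial.X - Polynomial.C c) ^ 2 ∣ lineHom σ w F := by
    intro c hc
    rw [map_mul] at hc
    refine X_sub_C_sq_dvd_of_dvd_mul (fun a ha => regular_pow ht k a ?_) hc
    rw [eval_lineHom] at ha
    simpa using ha
  have h0 := key 0 (X_sub_C_sq_dvd_lineHom σ w σ 0 (by simp) h)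
  have h1 := key t (X_sub_C_sq_dvd_lineHom σ w σ' t hσ h')
  rw [map_zero, sub_zero] at h0
  obtain ⟨g, hg⟩ := X_sq_mul_X_sub_C_sq_dvd ht h0 h1
  rw [← map_lineHom, hg]
  simp only [Polynomial.map_mul, Polynomial.map_pow, Polynomial.map_sub, Polynomial.map_X,
    Polynomial.map_C, het, map_zero, sub_zero]
  exact ⟨g.map e, by ring⟩

lemma X_sq_dvd_lineHom {A' : Type*} [CommRing A'] (e : A →+* A') {t : A}
    (ht : ∀ a, t * a = 0 → a = 0) {n : ℕ} (σ w : Fin n → A)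
    {F : MvPolynomial (Fin n) A} (k : ℕ)
    (h : C t ^ k * F ∈ RingHom.ker (MvPolynomial.eval σ) ^ 2) :
    Polynomial.X ^ 2 ∣ lineHom (fun j => e (σ j)) (fun j => e (w j)) (F.map e) := by
  have hc := X_sub_C_sq_dvd_lineHom σ w σ 0 (by simp) h
  rw [map_mul] at hc
  have h0 := X_sub_C_sq_dvd_of_dvd_mul (fun a ha => regular_pow ht k a
    (by rw [eval_lineHom] at ha; simpa using ha)) hc
  rw [map_zero, sub_zero] at h0
  obtain ⟨g, hg⟩ := h0
  rw [← map_lineHom, hg]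
  simp

end Divisibility

/-! ### Taylor forms and powers of the maximal ideal, tested on lines. -/

section Taylor

variable {n : ℕ}

lemma coeff_aeval_X_mul_C (v : Fin n → ℂ) (m : ℕ) (g : MvPolynomial (Fin n) ℂ) :
    (MvPolynomial.aeval (fun j => Polynomial.X * Polynomial.C (v j)) g : Polynomial ℂ).coeff m =
      MvPolynomial.eval v (homogeneousComponent m g) := by
  induction g using MvPolynomial.induction_on' with
  | monomial d a =>
    have h1 : (MvPolynomial.aeval (fun j => Polynomial.X * Polynomial.C (v j))
        (monomial d a) : Polynomial ℂ) =
        Polynomial.C (a * d.prod fun j e => v j ^ e) * Polynomial.X ^ d.degree := by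
      rw [MvPolynomial.aeval_monomial]
      simp only [mul_pow, Finset.prod_mul_distrib, Polynomial.C_mul, Finsupp.prod, map_prod, map_pow,
        Finsupp.degree_apply, ← Finset.prod_pow_eq_pow_sum]
      simp only [Polynomial.algebraMap_eq]
      ring
    rw [h1, Polynomial.coeff_C_mul, Polynomial.coeff_X_pow]
    rw [show monomial d a = C a * monomial d 1 by simp [C_mul_monomial],
      homogeneousComponent_C_mul]
    by_cases hd : m = d.degree
    · subst hd
      rw [homogeneousComponent_of_mem (isHomogeneous_monomial 1 rfl)]
      simp [MvPolynomial.eval_monomial]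
    · rw [homogeneousComponent_of_mem (isHomogeneous_monomial 1 rfl)]
      simp [hd]
  | add p q hp hq => simp only [map_add, Polynomial.coeff_add, hp, hq]

lemma eval_taylorForm (q v : Fin n → ℂ) (m : ℕ) (f : MvPolynomial (Fin n) ℂ) :
    MvPolynomial.eval v (taylorForm q m f) = (lineHom q v f).coeff m := by
  rw [taylorForm, ← coeff_aeval_X_mul_C]
  congr 1
  have h : (MvPolynomial.aeval (fun j => (Polynomial.X * Polynomial.C (v j) :
      Polynomial ℂ))).comp (recenter q) = lineHom q v := by
    refine MvPolynomial.algHom_ext (fun j => ?_)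
    simp [recenter, lineHom]
  exact DFunLike.congr_fun h f

lemma X_sub_C_mem_pointIdeal (q : Fin n → ℂ) (j : Fin n) : X j - C (q j) ∈ pointIdeal q := by
  simp [pointIdeal, RingHom.mem_ker]

lemma mem_pointIdeal_pow_of_recenter_mem (q : Fin n → ℂ) (m : ℕ) {f : MvPolynomial (Fin n) ℂ}
    (hf : recenter q f ∈ idealOfVars (Fin n) ℂ ^ m) : f ∈ pointIdeal q ^ m := by
  have h : (recenter (-q)).comp (recenter q) = AlgHom.id ℂ _ := by
    refine MvPolynomial.algHom_ext (fun j => ?_)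
    simp [recenter]
  have h1 : (idealOfVars (Fin n) ℂ).map (recenter (-q)) ≤ pointIdeal q := by
    rw [idealOfVars, Ideal.map_span, Ideal.span_le]
    rintro _ ⟨_, ⟨j, rfl⟩, rfl⟩
    simp [recenter, pointIdeal, RingHom.mem_ker]
  have h2 := Ideal.mem_map_of_mem (recenter (-q)) hf
  rw [Ideal.map_pow] at h2
  have h3 : recenter (-q) (recenter q f) = f := DFunLike.congr_fun h f
  rw [h3] at h2
  exact Ideal.pow_right_mono h1 m h2

lemma mem_pointIdeal_pow_iff (q : Fin n → ℂ) (m : ℕ) (f : MvPolynomial (Fin n) ℂ) :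
    f ∈ pointIdeal q ^ m ↔ ∀ v, Polynomial.X ^ m ∣ lineHom q v f := by
  constructor
  · intro hf v
    rw [Polynomial.X_pow_dvd_iff]
    intro d hd
    have h1 := recenter_mem q m hf
    rw [mem_pow_idealOfVars_iff'] at h1
    have : taylorForm q d f = 0 := by
      ext x
      rw [taylorForm, coeff_homogeneousComponent, coeff_zero]
      split_ifs with hx
      · exact h1 x (by omega)
      · rfl
    rw [← eval_taylorForm, this, map_zero]
  · intro h
    apply mem_pointIdeal_pow_of_recenter_mem
    rw [mem_pow_idealOfVars_iff']
    intro x hx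
    have h1 : taylorForm q x.degree f = 0 := by
      -- Over an infinite field a form that vanishes at every vector is zero, so lines through `q`
      -- detect every Taylor form.
      apply MvPolynomial.funext
      intro v
      rw [eval_taylorForm, map_zero]
      exact (Polynomial.X_pow_dvd_iff.mp (h v)) _ hx
    have h2 := congrArg (coeff x) h1
    rw [taylorForm, coeff_homogeneousComponent, if_pos rfl] at h2
    simpa using h2

lemma sub_C_eval_mem_span (q : Fin n → ℂ) (f : MvPolynomial (Fin n) ℂ) :
    f - C (MvPolynomial.eval q f) ∈ Ideal.span (Set.range fun j : Fin n => X j - C (q j)) := by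
  induction f using MvPolynomial.induction_on with
  | C a => simp
  | add p p' hp hp' =>
    have := add_mem hp hp'
    rw [map_add, map_add]
    convert this using 1
    ring
  | mul_X p j hp =>
    have h1 : X j - C (q j) ∈ Ideal.span (Set.range fun j : Fin n => X j - C (q j)) :=
      Ideal.subset_span ⟨j, rfl⟩
    have := add_mem (Ideal.mul_mem_left _ p h1) (Ideal.mul_mem_left _ (C (q j)) hp)
    rw [map_mul, map_mul, MvPolynomial.eval_X]
    convert this using 1
    ring

lemma pointIdeal_eq_span (q : Fin n → ℂ) :
    pointIdeal q = Ideal.span (Set.range fun j : Fin n => X j - C (q j)) := by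
  apply le_antisymm
  · intro f hf
    have := sub_C_eval_mem_span q f
    rw [show MvPolynomial.eval q f = 0 from hf] at this
    simpa using this
  · rw [Ideal.span_le]
    rintro _ ⟨j, rfl⟩
    exact X_sub_C_mem_pointIdeal q j

end Taylor

/-! ### Spanning over `ℂ` and detection by dual functionals. -/

section Generators

variable {S ι : Type*} [CommRing S] [Algebra ℂ S]

/-- Every ring element is a constant plus an element of `m`, so linear combinations with ring
coefficients are complex ones up to `m * Ideal.span T`. -/
lemma span_subset_submodule {m : Ideal S} (hm : ∀ g : S, ∃ c : ℂ, g - algebraMap ℂ S c ∈ m)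
    (T : Set S) (N : Submodule ℂ S) (hT : T ⊆ N) (hN : ∀ g ∈ m * Ideal.span T, g ∈ N) :
    ∀ f ∈ Ideal.span T, f ∈ N := by
  intro f hf
  suffices f ∈ Ideal.span T ∧ f ∈ N from this.2
  induction hf using Submodule.span_induction with
  | mem x hx => exact ⟨Ideal.subset_span hx, hT hx⟩
  | zero => exact ⟨zero_mem _, zero_mem _⟩
  | add x y _ _ hx hy => exact ⟨add_mem hx.1 hy.1, add_mem hx.2 hy.2⟩
  | smul g x _ hx =>
    refine ⟨Ideal.mul_mem_left _ g hx.1, ?_⟩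
    obtain ⟨c, hc⟩ := hm g
    have h1 := hN _ (Ideal.mul_mem_mul hc hx.1)
    have h2 := N.smul_mem c hx.2
    have h3 := add_mem h1 h2
    rwa [sub_mul, ← Algebra.smul_def, sub_add_cancel] at h3

/-- The functionals kill `J` and are diagonal on `g`, so they recover the coefficients of `f` modulo
`J`. -/
lemma mem_of_mem_span_sup [Fintype ι] (J : Ideal S) (g : ι → S) (E : ι → S →ₗ[ℂ] ℂ)
    (hJ : ∀ p, ∀ f ∈ J, E p f = 0) (hg : ∀ p, E p (g p) ≠ 0)
    (hg' : ∀ p p', p ≠ p' → E p (g p') = 0) {f : S}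
    (hf : f ∈ Submodule.span ℂ (Set.range g) ⊔ J.restrictScalars ℂ) (hE : ∀ p, E p f = 0) :
    f ∈ J := by
  obtain ⟨x, hx, y, hy, rfl⟩ := Submodule.mem_sup.mp hf
  obtain ⟨c, rfl⟩ := (Submodule.mem_span_range_iff_exists_fun ℂ).mp hx
  have hc : ∀ p, c p = 0 := by
    intro p
    have h := hE p
    rw [map_add, hJ p y hy, add_zero, map_sum, Finset.sum_eq_single p] at h
    · rw [map_smul, smul_eq_mul] at h
      exact (mul_eq_zero.mp h).resolve_right (hg p)
    · intro p' _ hp'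
      rw [map_smul, hg' p p' hp'.symm, smul_zero]
    · simp
  simpa [hc] using hy

end Generators

/-! ### Quartics generated by the known elements of the limit. -/

section Relations

variable {S ι : Type*} [CommRing S] [Fintype ι] [DecidableEq ι] {l : ι → S}
  (hsum : ∑ i, l i = 0)

include hsum in
lemma eq_neg_sum_erase (i : ι) : l i = -∑ j ∈ Finset.univ.erase i, l j := by
  rw [eq_neg_iff_add_eq_zero, Finset.add_sum_erase _ _ (Finset.mem_univ i), hsum]

variable {J : Ideal S}
  (h₃ : ∀ i j k, i ≠ j → i ≠ k → j ≠ k → l i * l j * l k ∈ J)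

include hsum h₃

/-- The relation replaces `l i + l j` by minus the sum of the other forms, which leaves only
products of three distinct forms. -/
lemma mul_mul_add_mem {i j : ι} (hij : i ≠ j) : l i * l j * (l i + l j) ∈ J := by
  have h : l i + l j = -∑ k ∈ (Finset.univ.erase i).erase j, l k := by
    rw [eq_neg_iff_add_eq_zero, add_assoc, Finset.add_sum_erase _ _ (by simp [hij.symm]),
      Finset.add_sum_erase _ _ (Finset.mem_univ i), hsum]
  rw [h, mul_neg, Finset.mul_sum]
  refine neg_mem (sum_mem fun k hk => ?_)
  simp only [Finset.mem_erase, Finset.mem_univ, and_true] at hk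
  exact h₃ i j k hij hk.2.symm hk.1.symm

variable (h₄ : ∀ i j, i ≠ j → l i ^ 2 * l j ^ 2 ∈ J)

include h₄

lemma cube_mul_mem {i j : ι} (hij : i ≠ j) : l i ^ 3 * l j ∈ J := by
  have := sub_mem (Ideal.mul_mem_left J (l i) (mul_mul_add_mem hsum h₃ hij)) (h₄ i j hij)
  convert this using 1
  ring

lemma sq_mul_mul_mem (i j k : ι) : l i * l i * l j * l k ∈ J := by
  have h5 : l i ^ 4 ∈ J := by
    have : l i ^ 4 = -∑ j ∈ Finset.univ.erase i, l i ^ 3 * l j := by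
      rw [← Finset.mul_sum, ← mul_neg, ← eq_neg_sum_erase hsum i]
      ring
    rw [this]
    refine neg_mem (sum_mem fun j hj => cube_mul_mem hsum h₃ h₄ (Finset.ne_of_mem_erase hj).symm)
  rcases eq_or_ne i j with rfl | hij
  · rcases eq_or_ne i k with rfl | hik
    · convert h5 using 1
      ring
    · convert cube_mul_mem hsum h₃ h₄ hik using 1
      ring
  · rcases eq_or_ne i k with rfl | hik
    · convert cube_mul_mem hsum h₃ h₄ hij using 1
      ring
    · rcases eq_or_ne j k with rfl | hjk
      · convert h₄ i j hij using 1
        ring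
      · convert Ideal.mul_mem_left J (l i) (h₃ i j k hij hik hjk) using 1
        ring

/-- Among the first three factors of a quartic monomial either two coincide, which is
`sq_mul_mul_mem`, or all are distinct, which is `h₃`. -/
lemma span_pow_four_le : Ideal.span (Set.range l) ^ 4 ≤ J := by
  rw [show Ideal.span (Set.range l) ^ 4 = Ideal.span (Set.range l) * Ideal.span (Set.range l) *
    Ideal.span (Set.range l) * Ideal.span (Set.range l) by ring]
  simp only [Ideal.span_mul_span']
  rw [Ideal.span_le]
  rintro _ ⟨_, ⟨_, ⟨_, ⟨i, rfl⟩, _, ⟨j, rfl⟩, rfl⟩, _, ⟨k, rfl⟩, rfl⟩, _, ⟨m, rfl⟩, rfl⟩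
  change l i * l j * l k * l m ∈ J
  rcases eq_or_ne i j with rfl | hij
  · exact sq_mul_mul_mem hsum h₃ h₄ i k m
  rcases eq_or_ne i k with rfl | hik
  · convert sq_mul_mul_mem hsum h₃ h₄ i j m using 1
    ring
  rcases eq_or_ne j k with rfl | hjk
  · convert sq_mul_mul_mem hsum h₃ h₄ j i m using 1
    ring
  exact Ideal.mul_mem_right _ _ (h₃ i j k hij hik hjk)

end Relations

/-! ### Spanning sets for quadrics and cubics modulo higher order. -/

section Spanning

open scoped Pointwise

variable {S ι : Type*} [CommRing S] [Algebra ℂ S] [Fintype ι] [LinearOrder ι] {l : ι → S}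
  (hsum : ∑ i, l i = 0)
  (hm : ∀ g : S, ∃ c : ℂ, g - algebraMap ℂ S c ∈ Ideal.span (Set.range l))

include hsum hm

lemma mem_span_mul_sup_of_mem_sq {f : S} (hf : f ∈ Ideal.span (Set.range l) ^ 2) :
    f ∈ Submodule.span ℂ (Set.range fun p : {p : ι × ι // p.1 < p.2} => l p.1.1 * l p.1.2) ⊔
      (Ideal.span (Set.range l) ^ 3).restrictScalars ℂ := by
  set N := Submodule.span ℂ (Set.range fun p : {p : ι × ι // p.1 < p.2} => l p.1.1 * l p.1.2) ⊔
      (Ideal.span (Set.range l) ^ 3).restrictScalars ℂ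
  have hne : ∀ i j, i ≠ j → l i * l j ∈ N := by
    intro i j hij
    apply Submodule.mem_sup_left
    rcases lt_or_gt_of_ne hij with h | h
    · exact Submodule.subset_span ⟨⟨(i, j), h⟩, rfl⟩
    · exact Submodule.subset_span ⟨⟨(j, i), h⟩, mul_comm _ _⟩
  have hspan : Ideal.span (Set.range l) ^ 2 = Ideal.span (Set.range l * Set.range l) := by
    rw [sq, Ideal.span_mul_span']
  rw [hspan] at hf
  refine span_subset_submodule hm _ N ?_ ?_ f hf
  · rintro _ ⟨_, ⟨i, rfl⟩, _, ⟨j, rfl⟩, rfl⟩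
    change l i * l j ∈ N
    rcases eq_or_ne i j with rfl | hij
    · have : l i * l i = -∑ j ∈ Finset.univ.erase i, l i * l j := by
        rw [← Finset.mul_sum, ← mul_neg, ← eq_neg_sum_erase hsum i]
      rw [this]
      exact neg_mem (sum_mem fun j hj => hne i j (Finset.ne_of_mem_erase hj).symm)
    · exact hne i j hij
  · intro g hg
    rw [← hspan, ← pow_succ'] at hg
    exact Submodule.mem_sup_right hg

lemma mem_span_sq_mul_sup_of_mem_cube {J : Ideal S}
    (h₃ : ∀ i j k, i ≠ j → i ≠ k → j ≠ k → l i * l j * l k ∈ J)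
    (h₄ : ∀ i j, i ≠ j → l i ^ 2 * l j ^ 2 ∈ J) {f : S}
    (hf : f ∈ Ideal.span (Set.range l) ^ 3) :
    f ∈ Submodule.span ℂ (Set.range fun p : {p : ι × ι // p.1 < p.2} =>
      l p.1.1 ^ 2 * l p.1.2) ⊔ J.restrictScalars ℂ := by
  set N := Submodule.span ℂ (Set.range fun p : {p : ι × ι // p.1 < p.2} =>
      l p.1.1 ^ 2 * l p.1.2) ⊔ J.restrictScalars ℂ
  have hJ : ∀ g ∈ J, g ∈ N := fun g hg => Submodule.mem_sup_right hg
  have hlt : ∀ i j, i < j → l i ^ 2 * l j ∈ N := fun i j h =>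
    Submodule.mem_sup_left (Submodule.subset_span ⟨⟨(i, j), h⟩, rfl⟩)
  have hne : ∀ i j, i ≠ j → l i ^ 2 * l j ∈ N := by
    intro i j hij
    rcases lt_or_gt_of_ne hij with h | h
    · exact hlt i j h
    -- Since `l i * l j * (l i + l j)` lies in `J`, exchanging the two indices only changes the sign
    -- modulo `J`; one ordering of each pair suffices.
    · have := sub_mem (hJ _ (mul_mul_add_mem hsum h₃ hij)) (hlt j i h)
      convert this using 1
      ring
  have hsq : ∀ i j, l i ^ 2 * l j ∈ N := by
    intro i j
    rcases eq_or_ne i j with rfl | hij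
    · have : l i ^ 2 * l i = -∑ j ∈ Finset.univ.erase i, l i ^ 2 * l j := by
        rw [← Finset.mul_sum, ← mul_neg, ← eq_neg_sum_erase hsum i]
      rw [this]
      exact neg_mem (sum_mem fun j hj => hne i j (Finset.ne_of_mem_erase hj).symm)
    · exact hne i j hij
  have hspan : Ideal.span (Set.range l) ^ 3 =
      Ideal.span (Set.range l * Set.range l * Set.range l) := by
    rw [pow_succ, sq, Ideal.span_mul_span', Ideal.span_mul_span']
  rw [hspan] at hf
  refine span_subset_submodule hm _ N ?_ ?_ f hf
  · rintro _ ⟨_, ⟨_, ⟨i, rfl⟩, _, ⟨j, rfl⟩, rfl⟩, _, ⟨k, rfl⟩, rfl⟩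
    change l i * l j * l k ∈ N
    rcases eq_or_ne i j with rfl | hij
    · convert hsq i k using 1
      ring
    rcases eq_or_ne i k with rfl | hik
    · convert hsq i j using 1
      ring
    rcases eq_or_ne j k with rfl | hjk
    · convert hsq j i using 1
      ring
    exact hJ _ (h₃ i j k hij hik hjk)
  · intro g hg
    rw [← hspan, ← pow_succ'] at hg
    exact hJ _ (span_pow_four_le hsum h₃ h₄ hg)

end Spanning

/-! ### Linear forms centred at `q` and their restrictions to lines. -/

section LinearForms

variable {n : ℕ}

/-- A linear form on the tangent space at `q`, as a polynomial vanishing at `q`. -/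
def linForm (q : Fin n → ℂ) : ((Fin n → ℂ) →ₗ[ℂ] ℂ) →ₗ[ℂ] MvPolynomial (Fin n) ℂ where
  toFun φ := ∑ j, C (φ (Pi.single j 1)) * (X j - C (q j))
  map_add' φ ψ := by simp [add_mul, Finset.sum_add_distrib]
  map_smul' c φ := by simp [Finset.mul_sum, mul_assoc, MvPolynomial.smul_eq_C_mul]

lemma linForm_apply (q : Fin n → ℂ) (φ : (Fin n → ℂ) →ₗ[ℂ] ℂ) :
    linForm q φ = ∑ j, C (φ (Pi.single j 1)) * (X j - C (q j)) := rfl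

lemma apply_eq_sum_single (φ : (Fin n → ℂ) →ₗ[ℂ] ℂ) (w : Fin n → ℂ) :
    φ w = ∑ j, φ (Pi.single j 1) * w j := by
  conv_lhs => rw [pi_eq_sum_univ' w, map_sum]
  refine Finset.sum_congr rfl fun j _ => ?_
  rw [map_smul, smul_eq_mul, mul_comm]

lemma lineHom_linForm (q w : Fin n → ℂ) (φ : (Fin n → ℂ) →ₗ[ℂ] ℂ) :
    lineHom q w (linForm q φ) = Polynomial.X * Polynomial.C (φ w) := by
  rw [linForm_apply, apply_eq_sum_single φ w]
  simp only [map_sum, map_mul, map_sub, Finset.mul_sum]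
  refine Finset.sum_congr rfl fun j _ => ?_
  simp [lineHom]
  ring

lemma linForm_proj (q : Fin n → ℂ) (j : Fin n) :
    linForm q (LinearMap.proj j) = X j - C (q j) := by
  rw [linForm_apply, Finset.sum_eq_single j]
  · simp
  · intro k _ hk
    simp [hk.symm]
  · simp

lemma linForm_mem_pointIdeal (q : Fin n → ℂ) (φ : (Fin n → ℂ) →ₗ[ℂ] ℂ) :
    linForm q φ ∈ pointIdeal q :=
  sum_mem fun j _ => Ideal.mul_mem_left _ _ (X_sub_C_mem_pointIdeal q j)

lemma lineHom_smul (q w : Fin n → ℂ) (c : ℂ) (f : MvPolynomial (Fin n) ℂ) :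
    lineHom q (c • w) f = (lineHom q w f).comp (Polynomial.C c * Polynomial.X) := by
  have h : lineHom q (c • w) =
      (Polynomial.aeval (Polynomial.C c * Polynomial.X)).comp (lineHom q w) := by
    refine MvPolynomial.algHom_ext fun j => ?_
    simp [lineHom]
    ring
  rw [h, AlgHom.comp_apply, Polynomial.comp_eq_aeval]

/-- The coefficient of degree `m` of the restriction of a polynomial to a line through `q`. -/
def lineCoeff (q w : Fin n → ℂ) (m : ℕ) : MvPolynomial (Fin n) ℂ →ₗ[ℂ] ℂ :=
  Polynomial.lcoeff ℂ m ∘ₗ (lineHom q w).toLinearMap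

lemma lineCoeff_apply (q w : Fin n → ℂ) (m : ℕ) (f : MvPolynomial (Fin n) ℂ) :
    lineCoeff q w m f = (lineHom q w f).coeff m := rfl

lemma lineCoeff_two (q w : Fin n → ℂ) (φ ψ : (Fin n → ℂ) →ₗ[ℂ] ℂ) :
    lineCoeff q w 2 (linForm q φ * linForm q ψ) = φ w * ψ w := by
  rw [lineCoeff_apply, map_mul, lineHom_linForm, lineHom_linForm,
    show (Polynomial.X * Polynomial.C (φ w)) * (Polynomial.X * Polynomial.C (ψ w)) =
      Polynomial.C (φ w * ψ w) * Polynomial.X ^ 2 by rw [Polynomial.C_mul]; ring,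
    Polynomial.coeff_C_mul_X_pow, if_pos rfl]

lemma lineCoeff_three (q w : Fin n → ℂ) (φ ψ χ : (Fin n → ℂ) →ₗ[ℂ] ℂ) :
    lineCoeff q w 3 (linForm q φ * linForm q ψ * linForm q χ) = φ w * ψ w * χ w := by
  rw [lineCoeff_apply, map_mul, map_mul, lineHom_linForm, lineHom_linForm, lineHom_linForm,
    show (Polynomial.X * Polynomial.C (φ w)) * (Polynomial.X * Polynomial.C (ψ w)) *
      (Polynomial.X * Polynomial.C (χ w)) =
      Polynomial.C (φ w * ψ w * χ w) * Polynomial.X ^ 3 by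
        rw [Polynomial.C_mul, Polynomial.C_mul]; ring,
    Polynomial.coeff_C_mul_X_pow, if_pos rfl]

end LinearForms

/-! ### Barycentric forms and interpolation at the differences `v i - v j`. -/

section Barycentric

variable {n : ℕ} {ι : Type*} (b : Module.Basis ι ℂ ((Fin n → ℂ) × ℂ))

/-- The linear parts of the barycentric coordinates with respect to affinely independent points
`v i` of `ℂⁿ`, given as the basis `(v i, 1)` of `ℂⁿ × ℂ`. -/
def bary (k : ι) : (Fin n → ℂ) →ₗ[ℂ] ℂ := b.coord k ∘ₗ LinearMap.inl ℂ (Fin n → ℂ) ℂ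

lemma bary_apply (k : ι) (w : Fin n → ℂ) : bary b k w = b.repr (w, 0) k := rfl

variable {b} {v : ι → Fin n → ℂ} (hb : ∀ i, b i = (v i, 1))

include hb

lemma bary_sub [DecidableEq ι] (k i j : ι) :
    bary b k (v i - v j) = (if i = k then 1 else 0) - (if j = k then 1 else 0) := by
  have h : ((v i - v j, 0) : (Fin n → ℂ) × ℂ) = b i - b j := by simp [hb]
  rw [bary_apply, h, map_sub, b.repr_self, b.repr_self]
  simp [Finsupp.single_apply]

variable [Fintype ι]

lemma sum_bary : ∑ k, bary b k = 0 := by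
  ext1 w
  ext
  have h := congrArg Prod.snd (b.sum_repr ((LinearMap.single ℂ (fun _ => ℂ) w) 1, (0 : ℂ)))
  simpa [hb, Prod.snd_sum, bary_apply] using h

lemma sum_bary_smul (w : Fin n → ℂ) : ∑ k, bary b k w • v k = w := by
  have h := congrArg Prod.fst (b.sum_repr (w, (0 : ℂ)))
  simpa [hb, Prod.fst_sum, bary_apply] using h

lemma sum_linForm_bary (q : Fin n → ℂ) : ∑ k, linForm q (bary b k) = 0 := by
  rw [← map_sum, sum_bary hb, map_zero]

lemma span_linForm_bary (q : Fin n → ℂ) :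
    Ideal.span (Set.range fun k => linForm q (bary b k)) = pointIdeal q := by
  apply le_antisymm
  · rw [Ideal.span_le]
    rintro _ ⟨k, rfl⟩
    exact linForm_mem_pointIdeal q _
  · rw [pointIdeal_eq_span, Ideal.span_le]
    rintro _ ⟨j, rfl⟩
    have h : (LinearMap.proj j : (Fin n → ℂ) →ₗ[ℂ] ℂ) = ∑ k, v k j • bary b k := by
      refine LinearMap.ext fun w => ?_
      have := congrFun (sum_bary_smul hb w) j
      simp only [Finset.sum_apply, Pi.smul_apply, smul_eq_mul] at this
      simp only [LinearMap.proj_apply, LinearMap.sum_apply, LinearMap.smul_apply, smul_eq_mul]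
      rw [← this]
      exact Finset.sum_congr rfl fun k _ => mul_comm _ _
    change X j - C (q j) ∈ _
    rw [← linForm_proj, h, map_sum]
    refine sum_mem fun k _ => ?_
    rw [map_smul, MvPolynomial.smul_eq_C_mul]
    exact Ideal.mul_mem_left _ _ (Ideal.subset_span ⟨k, rfl⟩)

omit [Fintype ι] hb in
lemma exists_sub_algebraMap_mem (q : Fin n → ℂ) (g : MvPolynomial (Fin n) ℂ) :
    ∃ c : ℂ, g - algebraMap ℂ _ c ∈ pointIdeal q :=
  ⟨MvPolynomial.eval q g, by simp [pointIdeal, RingHom.mem_ker, MvPolynomial.algebraMap_eq]⟩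

variable [LinearOrder ι]

/-- At `v i - v j` the only nonzero product of two distinct barycentric forms is that of indices `i`
and `j`, with value `-1`; hence evaluations at the differences determine the quadratic part. -/
lemma mem_pointIdeal_cube {q : Fin n → ℂ} {f : MvPolynomial (Fin n) ℂ}
    (hf : f ∈ pointIdeal q ^ 2) (hE : ∀ i j, lineCoeff q (v i - v j) 2 f = 0) :
    f ∈ pointIdeal q ^ 3 := by
  have hs := span_linForm_bary hb q
  rw [← hs] at hf
  have h := mem_span_mul_sup_of_mem_sq (sum_linForm_bary hb q)
    (by rw [hs]; exact exists_sub_algebraMap_mem q) hf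
  rw [hs] at h
  refine mem_of_mem_span_sup _ _
    (fun p : {p : ι × ι // p.1 < p.2} => lineCoeff q (v p.1.1 - v p.1.2) 2) ?_ ?_ ?_ h
    (fun p => hE _ _)
  · intro p g hg
    exact Polynomial.X_pow_dvd_iff.mp ((mem_pointIdeal_pow_iff q 3 g).mp hg _) 2 (by norm_num)
  · rintro ⟨⟨i, j⟩, hij⟩
    have hij : i < j := hij
    simp [lineCoeff_two, bary_sub hb, hij.ne, hij.ne']
  · rintro ⟨⟨i, j⟩, hij⟩ ⟨⟨i', j'⟩, hij'⟩ hne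
    have hij : i < j := hij
    have hij' : i' < j' := hij'
    simp only [lineCoeff_two, bary_sub hb]
    simp only [ne_eq, Subtype.mk.injEq, Prod.mk.injEq] at hne
    grind

/-- The same duality in degree 3, now between the `l i ^ 2 * l j` with `i < j` and evaluation at `v
i - v j`. -/
lemma mem_of_lineCoeff_three_eq_zero {q : Fin n → ℂ} {J : Ideal (MvPolynomial (Fin n) ℂ)}
    (h₃ : ∀ i j k, i ≠ j → i ≠ k → j ≠ k →
      linForm q (bary b i) * linForm q (bary b j) * linForm q (bary b k) ∈ J)
    (h₄ : ∀ i j, i ≠ j → linForm q (bary b i) ^ 2 * linForm q (bary b j) ^ 2 ∈ J)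
    (hJ : ∀ g ∈ J, ∀ i j, i ≠ j → lineCoeff q (v i - v j) 3 g = 0)
    {f : MvPolynomial (Fin n) ℂ} (hf : f ∈ pointIdeal q ^ 3)
    (hE : ∀ i j, i ≠ j → lineCoeff q (v i - v j) 3 f = 0) : f ∈ J := by
  have hs := span_linForm_bary hb q
  rw [← hs] at hf
  have h := mem_span_sq_mul_sup_of_mem_cube (sum_linForm_bary hb q)
    (by rw [hs]; exact exists_sub_algebraMap_mem q) h₃ h₄ hf
  refine mem_of_mem_span_sup _ _
    (fun p : {p : ι × ι // p.1 < p.2} => lineCoeff q (v p.1.1 - v p.1.2) 3) ?_ ?_ ?_ h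
    (fun p => hE _ _ p.2.ne)
  · intro p g hg
    exact hJ g hg _ _ p.2.ne
  · rintro ⟨⟨i, j⟩, hij⟩
    have hij : i < j := hij
    simp [sq, lineCoeff_three, bary_sub hb, hij.ne, hij.ne']
  · rintro ⟨⟨i, j⟩, hij⟩ ⟨⟨i', j'⟩, hij'⟩ hne
    have hij : i < j := hij
    have hij' : i' < j' := hij'
    simp only [sq, lineCoeff_three, bary_sub hb]
    simp only [ne_eq, Subtype.mk.injEq, Prod.mk.injEq] at hne
    grind

omit [Fintype ι] [LinearOrder ι] in
lemma linForm_bary_mul_mul_not_mem [DecidableEq ι] (q : Fin n → ℂ) {i j k : ι} (hij : i ≠ j)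
    (hik : i ≠ k) (hjk : j ≠ k) :
    linForm q (bary b i) * linForm q (bary b j) * linForm q (bary b k) ∉ pointIdeal q ^ 4 := by
  intro h
  -- At the vector `v i + v j - 2 v k` the three forms take the values `1`, `1`, `-2`, so the cubic
  -- coefficient is `-2`.
  have h1 := Polynomial.X_pow_dvd_iff.mp
    ((mem_pointIdeal_pow_iff q 4 _).mp h ((v i - v k) + (v j - v k))) 3 (by norm_num)
  rw [← lineCoeff_apply, lineCoeff_three] at h1
  simp only [map_add, bary_sub hb] at h1
  simp [hij, hij.symm, hik, hik.symm, hjk, hjk.symm] at h1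

end Barycentric

/-! ### The directions cut on `R` by the lines joining the lifts. -/

section Directions

variable {n : ℕ} {ι : Type} {b : Module.Basis ι ℂ ((Fin n → ℂ) × ℂ)} {v : ι → Fin n → ℂ}
  (hb : ∀ i, b i = (v i, 1)) {a : ι → ℙ ℂ ((Fin n → ℂ) × ℂ)}
  (ha : ∀ i, (a i).submodule = Submodule.span ℂ {(v i, (1 : ℂ))})

include ha in
lemma mk_mem_cutDirections_iff (w : Fin n → ℂ) (hw : w ≠ 0) :
    Projectivization.mk ℂ w hw ∈ cutDirections a ↔
      ∃ i j, i ≠ j ∧ ∃ c : ℂ, w = c • (v i - v j) := by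
  refine exists_congr fun i => exists_congr fun j => and_congr_right fun _ => ?_
  rw [lineThrough, Set.mem_ofPred_eq, ha, ha, inclR, Projectivization.map_mk,
    Projectivization.submodule_mk, Submodule.span_singleton_le_iff_mem, Submodule.mem_sup]
  constructor
  · rintro ⟨x, hx, y, hy, h⟩
    obtain ⟨α, rfl⟩ := Submodule.mem_span_singleton.mp hx
    obtain ⟨β, rfl⟩ := Submodule.mem_span_singleton.mp hy
    have h1 := congrArg Prod.fst h
    have h2 := congrArg Prod.snd h
    simp only [Prod.smul_mk, Prod.mk_add_mk, LinearMap.inl_apply, smul_eq_mul, mul_one] at h1 h2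
    -- Points of `R` have last coordinate 0, which forces the combination of `(v i, 1)` and `(v j,
    -- 1)` to be a multiple of their difference.
    obtain rfl : β = -α := by linear_combination h2
    exact ⟨α, by rw [← h1]; module⟩
  · rintro ⟨c, rfl⟩
    refine ⟨_, Submodule.mem_span_singleton.mpr ⟨c, rfl⟩, _,
      Submodule.mem_span_singleton.mpr ⟨-c, rfl⟩, ?_⟩
    ext <;> simp
    ring

include hb in
lemma sub_ne_zero_of_basis [DecidableEq ι] {i j : ι} (hij : i ≠ j) : v i - v j ≠ 0 := by
  intro h
  have := bary_sub hb i i j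
  rw [h, map_zero] at this
  simp [hij.symm] at this

lemma card_lt_pairs (m : ℕ) :
    Fintype.card {p : Fin m × Fin m // p.1 < p.2} = m.choose 2 := by
  rw [Fintype.card_subtype, Finset.card_filter, Fintype.sum_prod_type_right]
  have h : ∀ j : Fin m, ∑ i : Fin m, (if i < j then 1 else 0) = (j : ℕ) := by
    intro j
    rw [← Finset.card_filter, ← Fin.card_Iio]
    exact congrArg Finset.card (by ext; simp)
  simp only [h]
  rw [Fin.sum_univ_eq_sum_range (fun i => i), Finset.sum_range_id, Nat.choose_two_right]

include hb ha in
lemma ncard_cutDirections [LinearOrder ι] [Fintype ι] :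
    (cutDirections a).ncard = Fintype.card {p : ι × ι // p.1 < p.2} := by
  let g : {p : ι × ι // p.1 < p.2} → ℙ ℂ (Fin n → ℂ) := fun p =>
    Projectivization.mk ℂ (v p.1.1 - v p.1.2) (sub_ne_zero_of_basis hb p.2.ne)
  have hg : Function.Injective g := by
    rintro ⟨⟨i, j⟩, hij⟩ ⟨⟨i', j'⟩, hij'⟩ h
    obtain ⟨c, hc⟩ := (Projectivization.mk_eq_mk_iff' ℂ _ _ _ _).mp h
    have hij : i < j := hij
    have hij' : i' < j' := hij'
    change c • (v i' - v j') = v i - v j at hc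
    have h1 := congrArg (bary b i) hc
    have h2 := congrArg (bary b j) hc
    rw [map_smul, bary_sub hb, bary_sub hb, smul_eq_mul] at h1 h2
    simp only [Subtype.mk.injEq, Prod.mk.injEq]
    grind
  have hrange : cutDirections a = Set.range g := by
    ext p
    induction p using Projectivization.ind with
    | h w hw =>
      rw [mk_mem_cutDirections_iff ha]
      constructor
      · rintro ⟨i, j, hij, c, rfl⟩
        rcases lt_or_gt_of_ne hij with h | h
        · refine ⟨⟨(i, j), h⟩, ?_⟩
          exact ((Projectivization.mk_eq_mk_iff' ℂ _ _ _ _).mpr ⟨c, rfl⟩).symm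
        · refine ⟨⟨(j, i), h⟩, ?_⟩
          refine ((Projectivization.mk_eq_mk_iff' ℂ _ _ _ _).mpr ⟨-c, ?_⟩).symm
          rw [neg_smul, ← smul_neg, neg_sub]
      · rintro ⟨p, hp⟩
        obtain ⟨c, hc⟩ := (Projectivization.mk_eq_mk_iff' ℂ _ _ _ _).mp hp.symm
        exact ⟨_, _, p.2.ne, c, hc.symm⟩
  rw [hrange, ← Set.image_univ, Set.ncard_image_of_injective _ hg, Set.ncard_univ,
    Nat.card_eq_fintype_card]

include hb ha in
lemma mem_fatPointWithDirections_iff [DecidableEq ι] (q : Fin n → ℂ)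
    (f : MvPolynomial (Fin n) ℂ) :
    f ∈ fatPointWithDirections q 3 (cutDirections a) ↔
      f ∈ pointIdeal q ^ 3 ∧ ∀ i j, i ≠ j → lineCoeff q (v i - v j) 3 f = 0 := by
  refine and_congr_right fun _ => ⟨fun h i j hij => ?_, fun h w hw hB => ?_⟩
  · rw [lineCoeff_apply, ← eval_taylorForm]
    exact h _ (sub_ne_zero_of_basis hb hij)
      ((mk_mem_cutDirections_iff ha _ _).mpr ⟨i, j, hij, 1, (one_smul _ _).symm⟩)
  · obtain ⟨i, j, hij, c, rfl⟩ := (mk_mem_cutDirections_iff ha _ _).mp hB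
    have h1 := h i j hij
    rw [lineCoeff_apply, ← eval_taylorForm] at h1
    rw [eval_taylorForm] at h1 ⊢
    rw [lineHom_smul, Polynomial.comp_C_mul_X_coeff, h1, zero_mul]

end Directions

/-! ### Hyperplanes through all sections but one, and their limits. -/

section LiftedForms

variable {A : Type*} [CommRing A] [Algebra ℂ A] {n : ℕ} (t : A) (q : Fin n → ℂ)
  (u : Fin (n + 1) → Fin n → A)

/-- The homogeneous coordinates `(1, u i)` of a family of points. -/
def homogMatrix {A : Type*} [CommRing A] (u : Fin (n + 1) → Fin n → A) :
    Matrix (Fin (n + 1)) (Fin (n + 1)) A :=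
  Matrix.of fun i => Fin.cons 1 (u i)

/-- The hyperplane through the sections `q + t u i`, `i ≠ k`, by Cramer's rule. -/
def hyperplaneForm (k : Fin (n + 1)) : MvPolynomial (Fin n) A :=
  C (t * (homogMatrix u).adjugate 0 k) +
    ∑ j : Fin n, (X j - C (algebraMap ℂ A (q j))) * C ((homogMatrix u).adjugate j.succ k)

lemma eval_hyperplaneForm (i k : Fin (n + 1)) :
    MvPolynomial.eval (fun j => algebraMap ℂ A (q j) + t * u i j) (hyperplaneForm t q u k) =
      if i = k then t * (homogMatrix u).det else 0 := by
  have h := congrFun (congrFun (Matrix.mul_adjugate (homogMatrix u)) i) k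
  rw [Matrix.mul_apply, Fin.sum_univ_succ] at h
  simp only [homogMatrix, Matrix.of_apply, Fin.cons_zero, Fin.cons_succ, one_mul,
    Matrix.smul_apply, Matrix.one_apply, smul_eq_mul, mul_ite, mul_one, mul_zero] at h
  have h2 := congrArg (t * ·) h
  simp only [mul_add, Finset.mul_sum, mul_ite, mul_zero] at h2
  rw [show (if i = k then t * (homogMatrix u).det else 0) = _ from h2.symm]
  simp [hyperplaneForm, homogMatrix, mul_assoc]

variable (e : A →+* ℂ) (he : ∀ c, e (algebraMap ℂ A c) = c) {t} (het : e t = 0)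
  {b : Module.Basis (Fin (n + 1)) ℂ ((Fin n → ℂ) × ℂ)} {v : Fin (n + 1) → Fin n → ℂ}
  (hb : ∀ i, b i = (v i, 1)) {u}

include hb in
lemma det_homogMatrix_ne_zero : (homogMatrix v).det ≠ 0 := by
  intro h
  obtain ⟨c, hc, h0⟩ := Matrix.exists_vecMul_eq_zero_iff.mpr h
  apply hc
  have h1 : ∑ k, c k • b k = 0 := by
    simp only [hb]
    ext j
    · have := congrFun h0 j.succ
      simpa [Matrix.vecMul, dotProduct, homogMatrix, Prod.fst_sum] using this
    · have := congrFun h0 0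
      simpa [Matrix.vecMul, dotProduct, homogMatrix, Prod.snd_sum] using this
  funext k
  exact Fintype.linearIndependent_iff.mp b.linearIndependent c h1 k

include hb in
lemma adjugate_homogMatrix_succ (j : Fin n) (k : Fin (n + 1)) :
    (homogMatrix v).adjugate j.succ k = (homogMatrix v).det * bary b k (Pi.single j 1) := by
  set w : Fin n → ℂ := Pi.single j 1
  -- The barycentric coordinates of `w` express `(0, w)` through the rows `(1, v k)`; multiplying by
  -- the adjugate then gives Cramer's formula.
  have h1 : Matrix.vecMul (fun k => bary b k w) (homogMatrix v) = Pi.single j.succ 1 := by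
    funext a
    refine Fin.cases ?_ (fun a => ?_) a
    · have := LinearMap.congr_fun (sum_bary hb) w
      simpa [Matrix.vecMul, dotProduct, homogMatrix, LinearMap.sum_apply] using this
    · have := congrFun (sum_bary_smul hb w) a
      simp only [Finset.sum_apply, Pi.smul_apply, smul_eq_mul] at this
      simp only [Matrix.vecMul, dotProduct, homogMatrix, Matrix.of_apply, Fin.cons_succ, this, w]
      simp [Pi.single_apply]
  have h2 := congrFun (congrArg (Matrix.vecMul · (homogMatrix v).adjugate) h1) k
  simp only [Matrix.vecMul_vecMul, Matrix.mul_adjugate] at h2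
  simpa [Matrix.vecMul_smul] using h2.symm

include he het hb in
lemma map_hyperplaneForm (hu : ∀ i j, e (u i j) = v i j) (k : Fin (n + 1)) :
    (hyperplaneForm t q u k).map e = C (homogMatrix v).det * linForm q (bary b k) := by
  have hM : e.mapMatrix (homogMatrix u) = homogMatrix v := by
    ext i a
    refine Fin.cases ?_ (fun a => ?_) a <;> simp [homogMatrix, hu]
  have hadj : ∀ a k, e ((homogMatrix u).adjugate a k) = (homogMatrix v).adjugate a k := by
    intro a k
    rw [← hM, ← RingHom.map_adjugate]
    rfl
  rw [hyperplaneForm, linForm_apply]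
  simp only [map_add, map_mul, map_sum, map_sub, MvPolynomial.map_C, MvPolynomial.map_X, het, he,
    hadj, adjugate_homogMatrix_succ hb, Finset.mul_sum, map_zero, zero_mul, zero_add]
  exact Finset.sum_congr rfl fun j _ => by ring

include he het hb in
lemma linForm_bary_mul_mul_mem (hu : ∀ i j, e (u i j) = v i j) {i j k : Fin (n + 1)}
    (hij : i ≠ j) (hik : i ≠ k) (hjk : j ≠ k) :
    linForm q (bary b i) * linForm q (bary b j) * linForm q (bary b k) ∈
      (⨅ i, RingHom.ker (MvPolynomial.eval fun a => algebraMap ℂ A (q a) + t * u i a) ^ 2).map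
        (MvPolynomial.map e) := by
  have hmem : ∀ {i k}, i ≠ k → hyperplaneForm t q u k ∈
      RingHom.ker (MvPolynomial.eval fun a => algebraMap ℂ A (q a) + t * u i a) := by
    intro i k h
    rw [RingHom.mem_ker, eval_hyperplaneForm, if_neg h]
  have h1 : hyperplaneForm t q u i * hyperplaneForm t q u j * hyperplaneForm t q u k ∈
      ⨅ i, RingHom.ker (MvPolynomial.eval fun a => algebraMap ℂ A (q a) + t * u i a) ^ 2 := by
    rw [Ideal.mem_iInf]
    intro m
    rw [sq]
    -- The section `m` misses at most one of the three hyperplanes, so two factors always vanish on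
    -- it.
    by_cases hmk : m = k
    · subst hmk
      exact Ideal.mul_mem_right _ _ (Ideal.mul_mem_mul (hmem hik.symm) (hmem hjk.symm))
    · by_cases hmi : m = i
      · subst hmi
        rw [mul_assoc]
        exact Ideal.mul_mem_left _ _ (Ideal.mul_mem_mul (hmem hij) (hmem hik))
      · rw [mul_right_comm]
        exact Ideal.mul_mem_right _ _ (Ideal.mul_mem_mul (hmem hmi) (hmem hmk))
  have h2 := Ideal.mem_map_of_mem (MvPolynomial.map e) h1
  simp only [map_mul, map_hyperplaneForm q e he het hb hu] at h2
  have hd := det_homogMatrix_ne_zero hb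
  -- Each hyperplane specializes to the determinant times a barycentric form; the inverse cube
  -- removes the three determinants.
  have h3 := Ideal.mul_mem_left _ (C ((homogMatrix v).det⁻¹ ^ 3)) h2
  convert h3 using 1
  have h4 : (C (homogMatrix v).det⁻¹ * C (homogMatrix v).det : MvPolynomial (Fin n) ℂ) = 1 := by
    rw [← map_mul, inv_mul_cancel₀ hd, map_one]
  rw [map_pow]
  calc linForm q (bary b i) * linForm q (bary b j) * linForm q (bary b k)
      = (C (homogMatrix v).det⁻¹ * C (homogMatrix v).det) ^ 3 *
        (linForm q (bary b i) * linForm q (bary b j) * linForm q (bary b k)) := by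
          rw [h4, one_pow, one_mul]
    _ = _ := by ring

include he het hb in
lemma linForm_bary_sq_mul_sq_mem (hu : ∀ i j, e (u i j) = v i j) {i j : Fin (n + 1)}
    (hij : i ≠ j) :
    linForm q (bary b i) ^ 2 * linForm q (bary b j) ^ 2 ∈
      (⨅ i, RingHom.ker (MvPolynomial.eval fun a => algebraMap ℂ A (q a) + t * u i a) ^ 2).map
        (MvPolynomial.map e) := by
  have hmem : ∀ {i k}, i ≠ k → hyperplaneForm t q u k ^ 2 ∈
      RingHom.ker (MvPolynomial.eval fun a => algebraMap ℂ A (q a) + t * u i a) ^ 2 := by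
    intro i k h
    refine Ideal.pow_mem_pow ?_ 2
    rw [RingHom.mem_ker, eval_hyperplaneForm, if_neg h]
  have h1 : hyperplaneForm t q u i ^ 2 * hyperplaneForm t q u j ^ 2 ∈
      ⨅ i, RingHom.ker (MvPolynomial.eval fun a => algebraMap ℂ A (q a) + t * u i a) ^ 2 := by
    rw [Ideal.mem_iInf]
    intro m
    by_cases hmj : m = j
    · subst hmj
      exact Ideal.mul_mem_right _ _ (hmem hij.symm)
    · exact Ideal.mul_mem_left _ _ (hmem hmj)
  have h2 := Ideal.mem_map_of_mem (MvPolynomial.map e) h1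
  simp only [map_mul, map_pow, map_hyperplaneForm q e he het hb hu] at h2
  have hd := det_homogMatrix_ne_zero hb
  have h3 := Ideal.mul_mem_left _ (C ((homogMatrix v).det⁻¹) ^ 4) h2
  convert h3 using 1
  have h4 : (C (homogMatrix v).det⁻¹ * C (homogMatrix v).det : MvPolynomial (Fin n) ℂ) = 1 := by
    rw [← map_mul, inv_mul_cancel₀ hd, map_one]
  calc linForm q (bary b i) ^ 2 * linForm q (bary b j) ^ 2
      = (C (homogMatrix v).det⁻¹ * C (homogMatrix v).det) ^ 4 *
        (linForm q (bary b i) ^ 2 * linForm q (bary b j) ^ 2) := by rw [h4, one_pow, one_mul]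
    _ = _ := by ring

end LiftedForms

/-! ### Holomorphic functions on the base and elements of the flat limit. -/

section Holomorphic

variable {n : ℕ} {U : Set ℂ}

lemma param_regular (hU : IsOpen U) (h0 : (0 : ℂ) ∈ U) (a : holo U) (ha : param U * a = 0) :
    a = 0 := by
  obtain ⟨f, g, hg, hfg⟩ := a
  have hne : ∀ z ∈ U, z ≠ 0 → g z = 0 := by
    intro z hz hz0
    have h1 : z * f ⟨z, hz⟩ = 0 := congrFun (congrArg Subtype.val ha) ⟨z, hz⟩
    rw [← hfg ⟨z, hz⟩]
    exact (mul_eq_zero.mp h1).resolve_left hz0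
  -- Multiplication by `t` loses the value at 0, which continuity restores.
  have hg0 : g 0 = 0 := by
    have hc : ContinuousAt g 0 := (hg.continuousOn.continuousAt (hU.mem_nhds h0))
    have h1 : Filter.Tendsto g (nhdsWithin 0 {0}ᶜ) (nhds (g 0)) := hc.mono_left nhdsWithin_le_nhds
    have h2 : Filter.Tendsto g (nhdsWithin 0 {0}ᶜ) (nhds 0) := by
      refine tendsto_const_nhds.congr' ?_
      filter_upwards [self_mem_nhdsWithin, mem_nhdsWithin_of_mem_nhds (hU.mem_nhds h0)]
        with z hz hzU
      exact (hne z hzU hz).symm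
    exact tendsto_nhds_unique h1 h2
  refine Subtype.ext (funext fun z => ?_)
  change f z = 0
  rw [hfg z]
  by_cases hz : (z : ℂ) = 0
  · rw [hz, hg0]
  · exact hne z z.2 hz

lemma evalZero_algebraMap (h0 : (0 : ℂ) ∈ U) (c : ℂ) : evalZero h0 (algebraMap ℂ (holo U) c) = c :=
  rfl

lemma evalZero_param (h0 : (0 : ℂ) ∈ U) : evalZero h0 (param U) = 0 := rfl

lemma sectionCoord_eq (s : ℂ → Fin n → ℂ) (hs : DifferentiableOn ℂ s U)
    (hs' : DifferentiableOn ℂ (dslope s 0) U) (j : Fin n) :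
    sectionCoord s hs j =
      algebraMap ℂ (holo U) (s 0 j) + param U * sectionCoord (dslope s 0) hs' j := by
  refine Subtype.ext (funext fun z => ?_)
  change s z j = s 0 j + z * dslope s 0 z j
  have := congrFun (sub_smul_dslope s 0 z) j
  simp only [sub_zero, Pi.smul_apply, smul_eq_mul, Pi.sub_apply] at this
  rw [this]
  ring

lemma evalZero_sectionCoord_dslope (h0 : (0 : ℂ) ∈ U) (s : ℂ → Fin n → ℂ)
    (hs' : DifferentiableOn ℂ (dslope s 0) U) (j : Fin n) :
    evalZero h0 (sectionCoord (dslope s 0) hs' j) = deriv s 0 j := by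
  change dslope s 0 0 j = _
  rw [dslope_same]

lemma le_flatClosure (I : Ideal (FamilyRing n U)) : I ≤ flatClosure I := Ideal.le_comap_map

lemma exists_pow_mul_mem_of_mem_flatClosure {I : Ideal (FamilyRing n U)} {F : FamilyRing n U}
    (hF : F ∈ flatClosure I) : ∃ k, C (param U) ^ k * F ∈ I := by
  rw [flatClosure, Ideal.mem_comap, IsLocalization.algebraMap_mem_map_algebraMap_iff
    (Submonoid.powers (C (param U) : FamilyRing n U))] at hF
  obtain ⟨_, ⟨k, rfl⟩, h⟩ := hF
  exact ⟨k, h⟩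

lemma exists_of_mem_flatLimit {h0 : (0 : ℂ) ∈ U} {I : Ideal (FamilyRing n U)}
    {f : MvPolynomial (Fin n) ℂ} (hf : f ∈ flatLimit h0 I) :
    ∃ (F : FamilyRing n U) (k : ℕ), C (param U) ^ k * F ∈ I ∧ F.map (evalZero h0) = f := by
  have hsurj : Function.Surjective (MvPolynomial.map (σ := Fin n) (evalZero h0)) :=
    MvPolynomial.map_surjective _ fun c => ⟨_, evalZero_algebraMap h0 c⟩
  obtain ⟨F, hF, rfl⟩ := (Ideal.mem_map_iff_of_surjective _ hsurj).mp hf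
  obtain ⟨k, hk⟩ := exists_pow_mul_mem_of_mem_flatClosure hF
  exact ⟨F, k, hk, rfl⟩

end Holomorphic

lemma linearIndependent_of_independent_mk {ι V : Type*} [AddCommGroup V] [Module ℂ V] (w : ι → V)
    (hw : ∀ i, w i ≠ 0)
    (h : Projectivization.Independent fun i => Projectivization.mk ℂ (w i) (hw i)) :
    LinearIndependent ℂ w := by
  rw [Projectivization.independent_iff] at h
  choose a ha using fun i => Projectivization.exists_smul_eq_mk_rep ℂ (w i) (hw i)
  have h2 : (Projectivization.rep ∘ fun i => Projectivization.mk ℂ (w i) (hw i)) = a • w :=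
    funext fun i => (ha i).symm
  rw [h2] at h
  simpa using h.units_smul a⁻¹

end

end Collapse

open Collapse MvPolynomial

/-- `n + 1` double points of `𝔸ⁿ` moving along holomorphic sections over a disk and collapsing to
`q` at `t = 0`, in general position: the points in which the lifted sections meet the exceptional
divisor `ℙⁿ` of the blow-up at `(q, 0)` are linearly independent. -/
theorem proposition2p9 (n : ℕ) (hn : 2 ≤ n) (c : ℂ) (r : ℝ) (h0 : (0 : ℂ) ∈ Metric.ball c r)
    (q : Fin n → ℂ) (s : Fin (n + 1) → ℂ → Fin n → ℂ)
    (hs : ∀ i, DifferentiableOn ℂ (s i) (Metric.ball c r)) (hq : ∀ i, s i 0 = q)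
    (hgen : Projectivization.Independent (fun i => Collapse.liftAtZero (s i))) :
    (Collapse.cutDirections (fun i => Collapse.liftAtZero (s i))).ncard = (n + 1).choose 2 ∧
    Collapse.HasMultiplicity (Collapse.flatLimit h0 (Collapse.doubleSections s hs)) q 3 ∧
    Collapse.flatLimit h0 (Collapse.doubleSections s hs) =
      Collapse.fatPointWithDirections q 3
        (Collapse.cutDirections (fun i => Collapse.liftAtZero (s i))) := by
  have hli := linearIndependent_of_independent_mk _ _ hgen
  set v : Fin (n + 1) → Fin n → ℂ := fun i => deriv (s i) 0 with hv
  let b : Module.Basis (Fin (n + 1)) ℂ ((Fin n → ℂ) × ℂ) :=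
    basisOfLinearIndependentOfCardEqFinrank hli (by simp)
  have hb : ∀ i, b i = (v i, 1) := fun i => by simp [b, hv]
  have ha : ∀ i, (liftAtZero (s i)).submodule = Submodule.span ℂ {(v i, (1 : ℂ))} :=
    fun i => Projectivization.submodule_mk _ _
  -- The quotient `(s i z - s i 0) / z`, completed by the derivative at 0, is holomorphic by removal
  -- of the singularity; it plays the role of `u i`.
  have hs' : ∀ i, DifferentiableOn ℂ (dslope (s i) 0) (Metric.ball c r) := fun i =>
    (Complex.differentiableOn_dslope (Metric.isOpen_ball.mem_nhds h0)).mpr (hs i)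
  set A := holo (Metric.ball c r)
  set t : A := param (Metric.ball c r)
  let u : Fin (n + 1) → Fin n → A := fun i => sectionCoord (dslope (s i) 0) (hs' i)
  have hu : ∀ i j, evalZero h0 (u i j) = v i j := fun i j =>
    evalZero_sectionCoord_dslope h0 (s i) (hs' i) j
  have hreg : ∀ a : A, t * a = 0 → a = 0 := param_regular Metric.isOpen_ball h0
  have hcoord : ∀ i, sectionCoord (s i) (hs i) = fun j => algebraMap ℂ A (q j) + t * u i j :=
    fun i => funext fun j => by rw [sectionCoord_eq (s i) (hs i) (hs' i) j, hq]
  have hI : doubleSections s hs = ⨅ i, RingHom.ker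
      (MvPolynomial.eval fun a => algebraMap ℂ A (q a) + t * u i a) ^ 2 := by
    simp only [doubleSections, sectionIdeal, hcoord]
  rw [hI]
  set I := ⨅ i, RingHom.ker (MvPolynomial.eval fun a => algebraMap ℂ A (q a) + t * u i a) ^ 2
  have hle : I.map (MvPolynomial.map (evalZero h0)) ≤ flatLimit h0 I :=
    Ideal.map_mono (le_flatClosure I)
  have h₃ : ∀ i j k, i ≠ j → i ≠ k → j ≠ k →
      linForm q (bary b i) * linForm q (bary b j) * linForm q (bary b k) ∈ flatLimit h0 I :=
    fun i j k hij hik hjk => hle (linForm_bary_mul_mul_mem q (evalZero h0)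
      (evalZero_algebraMap h0) (evalZero_param h0) hb hu hij hik hjk)
  have h₄ : ∀ i j, i ≠ j →
      linForm q (bary b i) ^ 2 * linForm q (bary b j) ^ 2 ∈ flatLimit h0 I :=
    fun i j hij => hle (linForm_bary_sq_mul_sq_mem q (evalZero h0)
      (evalZero_algebraMap h0) (evalZero_param h0) hb hu hij)
  have hq' : ∀ i, (fun j => evalZero h0 (algebraMap ℂ A (q j) + t * u i j)) = q := by
    intro i
    funext j
    rw [map_add, map_mul, evalZero_algebraMap, evalZero_param, zero_mul, add_zero]
  have hfour : ∀ f ∈ flatLimit h0 I, ∀ i j, Polynomial.X ^ 4 ∣ lineHom q (v i - v j) f := by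
    intro f hf i j
    obtain ⟨F, k, hF, rfl⟩ := exists_of_mem_flatLimit hf
    have hF' := Ideal.mem_iInf.mp hF
    -- The line starts at section `j` with direction `u i - u j`, so that it reaches section `i`
    -- exactly at the parameter `t`.
    have h := X_pow_four_dvd_lineHom (evalZero h0) hreg (evalZero_param h0) _
      (fun a => u i a - u j a) _ (fun a => by ring) k (hF' j) (hF' i)
    rw [hq'] at h
    convert h using 3
    funext a
    simp [hu]
  have hcube : ∀ f ∈ flatLimit h0 I, f ∈ pointIdeal q ^ 3 := by
    intro f hf
    refine mem_pointIdeal_cube hb ?_ fun i j =>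
      Polynomial.X_pow_dvd_iff.mp (hfour f hf i j) 2 (by norm_num)
    rw [mem_pointIdeal_pow_iff]
    intro w
    obtain ⟨F, k, hF, rfl⟩ := exists_of_mem_flatLimit hf
    -- For order 2 along an arbitrary direction a single section is enough; the one of index 0 is
    -- used.
    have h := X_sq_dvd_lineHom (evalZero h0) hreg _ (fun a => algebraMap ℂ A (w a)) k
      (Ideal.mem_iInf.mp hF 0)
    rw [hq'] at h
    exact h
  have hthree : ∀ f ∈ flatLimit h0 I, ∀ i j, i ≠ j → lineCoeff q (v i - v j) 3 f = 0 :=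
    fun f hf i j _ => Polynomial.X_pow_dvd_iff.mp (hfour f hf i j) 3 (by norm_num)
  refine ⟨?_, ⟨hcube, fun h => ?_⟩, ?_⟩
  · rw [ncard_cutDirections hb ha, card_lt_pairs]
  -- The bound `2 ≤ n` provides three distinct indices, hence a cubic `l i * l j * l k` in the
  -- limit.
  · have h01 : (⟨0, by omega⟩ : Fin (n + 1)) ≠ ⟨1, by omega⟩ := by simp
    have h02 : (⟨0, by omega⟩ : Fin (n + 1)) ≠ ⟨2, by omega⟩ := by simp
    have h12 : (⟨1, by omega⟩ : Fin (n + 1)) ≠ ⟨2, by omega⟩ := by simp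
    exact linForm_bary_mul_mul_not_mem hb q h01 h02 h12 (h (h₃ _ _ _ h01 h02 h12))
  · ext f
    rw [mem_fatPointWithDirections_iff hb ha]
    exact ⟨fun hf => ⟨hcube f hf, hthree f hf⟩, fun hf =>
      mem_of_lineCoeff_three_eq_zero hb h₃ h₄ hthree hf.1 hf.2⟩
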